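/- Static follow-back problem. Let $V$ be a finite set of users, let $u_0\notin V$ be a further user, and let $E$ be a directed graph on $V$, where an arc $u\to v$ means that $v$ follows $u$ and so receives the tweets of $u$. For each $v\in V$ let $r_v\in[0,1]$ be the probability that $v$ follows $u_0$ back if $u_0$ follows $v$, and let $p_v(u,S)\in[0,1]$ be the probability that $v$ reads and retweets the message tweeted or retweeted by $u$ when exactly the users in $S$ have already attempted, in vain, to influence $v$. Here $\{u\}\cup S\subseteq N(v):=\{u_0\}\cup\{u\in V:(u,v)\in E\}$ and $u\notin S$. Assume that the probabilities are those of a decreasing, order independent cascade model: - (decreasing) $p_v(u,S)\ge p_v(u,T)$ whenever $S\subseteq T\subseteq N(v)$ and $u\in N(v)\setminus T$; - (order independence) for all disjoint $S,T\subseteq N(v)$, the product $\prod_{i=1}^{m}\bigl(1-p_v(u_i,S\cup\{u_1,\dots,u_{i-1}\})\bigr)$ is the same for all enumerations $u_1,\dots,u_m$ of $T$. The user $u_0$ follows a set $B\subseteq V$. Every $v\in B$, independently, follows $u_0$ back with probability $r_v$, and nobody else follows $u_0$. Then $u_0$ tweets, and $u_0$ is the only node active (and contagious) at time $0$. Each node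 $u$ that becomes active at time $t$ makes one attempt on each inactive $v$ that follows $u$; simultaneous attempts on the same $v$ are made one after the other in an arbitrary order, each attempt succeeds with probability $p_v(u,S)$, where $S$ is the set of nodes that have attempted to influence $v$ before, and the nodes $v$ with a successful attempt become active at time $t+1$. Attempts on distinct nodes are independent. Let $\varphi(B)\subseteq V$ be the random set of users in $V$ that are active at the end of the cascade. Let $K\in\mathbb N$. The greedy algorithm starts from $B_0=\emptyset$ and at each of $K$ steps adds to the current set $B_i$ a user $v\in V\setminus B_i$ that maximizes the marginal gain $\mathbb E|\varphi(B_i\cup\{v\})|-\mathbb E|\varphi(B_i)|$, with ties broken arbitrarily (it leaves the set unchanged if no user is left). Then the greedy algorithm is a $(1-1/e)$-approximation algorithm for the problem of maximizing $\mathbb E|\varphi(B)|$ subject to $|B|\le K$: it always has an output, and every possible output $B$ satisfies $|B|\le K$ and $$\mathbb E|\varphi(B)|\;\ge\;\Bigl(1-\frac1e\Bigr)\,\mathbb E|\varphi(B')|\qquad\text{for all }B'\subseteq V\text{ with }|B'|\le K.$$ -/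

import Mathlib

open unitInterval

noncomputable section

/-! ## Independent coins -/

/-- The probability that, of a family of independent coins with success probabilities `q i`,
exactly those in `N` succeed. -/
def coinWeight {ι : Type*} [Fintype ι] [DecidableEq ι] (q : ι → I) (N : Finset ι) : ENNReal :=
  ∏ i, if i ∈ N then ENNReal.ofReal (q i) else ENNReal.ofReal (1 - q i)

theorem sum_coinWeight {ι : Type*} [Fintype ι] [DecidableEq ι] (q : ι → I) :
    ∑ N : Finset ι, coinWeight q N = 1 := by
  have h := Finset.prod_add (fun i => ENNReal.ofReal (q i))
    (fun i => ENNReal.ofReal (1 - q i)) (Finset.univ : Finset ι)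
  have h1 : ∀ i, ENNReal.ofReal (q i : ℝ) + ENNReal.ofReal (1 - q i) = 1 := fun i => by
    rw [← ENNReal.ofReal_add (q i).2.1 (by linarith [(q i).2.2])]
    simp
  simp only [h1, Finset.prod_const_one, Finset.powerset_univ] at h
  rw [h]
  refine Finset.sum_congr rfl fun N _ => ?_
  unfold coinWeight
  rw [Finset.prod_ite]
  congr 1
  · congr 1; ext; simp
  · congr 1; ext; simp

/-- The law of the random set of successes in independent coins with success
probabilities `q i`. -/
def indepCoins {ι : Type*} [Fintype ι] [DecidableEq ι] (q : ι → I) : PMF (Finset ι) :=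
  PMF.ofFintype (coinWeight q) (sum_coinWeight q)

/-! ## The order independent cascade model on a finite directed graph

An arc `u → v` means that `u` may influence `v`. The success probabilities are given as
`p v u S`: the probability that the attempt of `u` on `v` succeeds when exactly the nodes in `S`
have already attempted, in vain, to influence `v`. -/

section Cascade

variable {W : Type*} [Fintype W]

open Classical in
/-- The nodes that can attempt to influence `v`. -/
def inNbrs (G : Digraph W) (v : W) : Finset W := {u | G.Adj u v}

/-- The success probability of `u` on `v` does not increase when more nodes have already
attempted to influence `v`. -/
def IsDecreasing (G : Digraph W) (p : W → W → Finset W → I) : Prop :=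
  ∀ (v u : W) (S T : Finset W), S ⊆ T → T ⊆ inNbrs G v → u ∈ inNbrs G v → u ∉ T →
    p v u T ≤ p v u S

variable [DecidableEq W]

/-- The probability that all attempts on `v` by the nodes of a list, made one after the other
in the order of the list, fail, when the nodes of `S` have already attempted before. -/
def failProb (p : W → W → Finset W → I) (v : W) : Finset W → List W → I
  | _, [] => 1
  | S, u :: l => σ (p v u S) * failProb p v (insert u S) l

/-- Order independence: the probability that a set of attempts on `v` all fail does not depend
on the order in which these attempts are made. -/
def IsOrderIndependent (G : Digraph W) (p : W → W → Finset W → I) : Prop :=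
  ∀ (v : W) (S : Finset W) (l l' : List W), S ⊆ inNbrs G v → (∀ u ∈ l, u ∈ inNbrs G v ∧ u ∉ S) →
    l.Nodup → l.Perm l' → failProb p v S l = failProb p v S l'

/-- An arbitrary rule for ordering simultaneous attempts: `seq v S T` is the order in which the
nodes of `T` make their attempts on `v`, when those of `S` have attempted at earlier times. -/
structure AttemptOrder (W : Type*) where
  seq : W → Finset W → Finset W → List W
  nodup : ∀ v S T, (seq v S T).Nodup
  mem_seq : ∀ v S T u, u ∈ seq v S T ↔ u ∈ T

/-- A state of the cascade: the active nodes, and among them the contagious ones, i.e. those that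
have become active at the current time. -/
structure CascadeState (W : Type*) where
  active : Finset W
  contagious : Finset W

/-- The probability that `v` becomes active at the next time: it is inactive, and at least one of
the attempts of its contagious in-neighbours succeeds. As long as `v` is inactive, every active
in-neighbour that is no longer contagious has already attempted to influence `v`. -/
def activationProb (G : Digraph W) (p : W → W → Finset W → I) (ord : AttemptOrder W)
    (s : CascadeState W) (v : W) : I :=
  if v ∈ s.active then 0
  else
    let S := inNbrs G v ∩ (s.active \ s.contagious)
    σ (failProb p v S (ord.seq v S (inNbrs G v ∩ s.contagious)))

/-- One time step: a random set `N` of nodes becomes active, independently for distinct nodes. -/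
def cascadeStep (G : Digraph W) (p : W → W → Finset W → I) (ord : AttemptOrder W)
    (s : CascadeState W) : PMF (CascadeState W) :=
  (indepCoins (activationProb G p ord s)).map fun N => ⟨s.active ∪ N, N⟩

/-- The law of the state after `n` time steps, from a given state. -/
def cascadeRun (G : Digraph W) (p : W → W → Finset W → I) (ord : AttemptOrder W) :
    ℕ → CascadeState W → PMF (CascadeState W)
  | 0, s => PMF.pure s
  | n + 1, s => (cascadeStep G p ord s).bind (cascadeRun G p ord n)

/-- The law of the final set of active nodes, from the initial active set `A`. A time step
without newly active nodes ends the process, which therefore has stopped after at most as many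
steps as there are nodes. -/
def finalActive (G : Digraph W) (p : W → W → Finset W → I) (ord : AttemptOrder W)
    (A : Finset W) : PMF (Finset W) :=
  (cascadeRun G p ord (Fintype.card W) ⟨A, A⟩).map CascadeState.active

end Cascade

/-! ## The follow-back problem

`V` is the set of users other than `u₀`, and `none : Option V` is `u₀`. -/

section FollowBack

variable {V : Type*}

/-- The propagation graph when `F` is the set of followers of `u₀`: an arc `u → v` means that
`v` receives the tweets of `u`. Arcs into `u₀` play no role, since `u₀` is active from the start. -/
def tweetGraph (E : Digraph V) (F : Finset V) : Digraph (Option V) where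
  Adj
    | some u, some v => E.Adj u v
    | none, some v => v ∈ F
    | _, none => False

variable [Fintype V] [DecidableEq V]

/-- The law of the set of users that retweet a tweet emitted by `u₀`, when `u₀` follows the users
in `B`: every `v ∈ B` independently follows back with probability `r v`, nobody else follows `u₀`,
and then the cascade starts from `u₀`. The user `u₀` is not counted. -/
def retweeters (E : Digraph V) (p : Option V → Option V → Finset (Option V) → I) (r : V → I)
    (ord : AttemptOrder (Option V)) (B : Finset V) : PMF (Finset V) :=
  (indepCoins fun v => if v ∈ B then r v else 0).bind fun F =>
    (finalActive (tweetGraph E F) p ord {none}).map fun A => Finset.univ.filter (some · ∈ A)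

/-- The expected number of users that retweet a tweet emitted by `u₀`, when `u₀` follows the
users in `B`. -/
def expectedRetweets (E : Digraph V) (p : Option V → Option V → Finset (Option V) → I) (r : V → I)
    (ord : AttemptOrder (Option V)) (B : Finset V) : ℝ :=
  ∑ C : Finset V, (retweeters E p r ord B C).toReal * (C.card : ℝ)

/-- `GreedyRun f k B`: the set `B` can be the choice of the greedy algorithm for the objective `f`
after `k` steps. Each step adds a new element with the largest marginal gain (ties are broken
arbitrarily), as long as there are elements left. -/
inductive GreedyRun (f : Finset V → ℝ) : ℕ → Finset V → Prop
  | start : GreedyRun f 0 ∅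
  | pick {k : ℕ} {B : Finset V} {v : V} : GreedyRun f k B → v ∉ B →
      (∀ w, w ∉ B → f (insert w B) - f B ≤ f (insert v B) - f B) →
      GreedyRun f (k + 1) (insert v B)
  | exhausted {k : ℕ} {B : Finset V} : GreedyRun f k B → (∀ v, v ∈ B) → GreedyRun f (k + 1) B

end FollowBack

end

/-!
The greedy guarantee holds for every nonnegative monotone submodular function
(`GreedyRun.one_sub_inv_exp_mul_le`), so it remains to show that the objective is one.

Draw beforehand the random set `R` of users that would follow back if asked. The followers of `u₀`
are then `B ∩ R`, and the objective is an average over `R` of functions `B ↦ S (B ∩ R)`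
(`expectedRetweets_eq`), where `S F` is the mean size of the cascade when exactly `F` follows `u₀`.
It suffices that `S` is monotone and submodular. To compare different sets `F` within a single
cascade, `u₀` is split into one source per user `v`, which can influence `v` only: the cascade on
the graph with followers `F` becomes the cascade started from the sources of the users in `F`
(`pmfMean_cascadeRun`).

A cascade is described by the set `D` of labels that have made their attempts and the set `C` of
contagious ones. Order independence implies that the attempts of a part of `C` can be delayed
without changing the law of the result (`finalMean_delay`). Hence the gain of an additional source
`s` can be computed by letting the cascade without `s` end, with final active set `X`, and starting
`s` only then (`finalMean_union_sources`, `finalMean_insert_source_sub`). As the success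
probabilities decrease with the set of earlier attempts, what `s` activates from `X` decreases
in `X`: by a monotone coupling of the coins (`coinMean_le_of_dominated`), in which the cascade from
the smaller set delays those attempts that have no counterpart in the other
(`finalMean_gain_le`). More sources give larger sets `X`, by the same delay, which is
submodularity (`finalMean_insert_source_sub_le`).
-/

noncomputable section

/-! ### Independent coins -/

section Coins

variable {V : Type*} [DecidableEq V]

/-- The mean of `h N`, where `N ⊆ s` is the random set of successes in independent coins with
success probabilities `q v`, for `v ∈ s`. Keeping `s` explicit allows induction on the set of
coins. -/
def coinMean (s : Finset V) (q : V → ℝ) (h : Finset V → ℝ) : ℝ :=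
  ∑ N ∈ s.powerset, (∏ v ∈ s, if v ∈ N then q v else 1 - q v) * h N

@[simp]
theorem coinMean_empty (q : V → ℝ) (h : Finset V → ℝ) : coinMean ∅ q h = h ∅ := by
  simp [coinMean]

theorem coinMean_insert {a : V} {s : Finset V} (ha : a ∉ s) (q : V → ℝ) (h : Finset V → ℝ) :
    coinMean (insert a s) q h =
      (1 - q a) * coinMean s q h + q a * coinMean s q fun N => h (insert a N) := by
  unfold coinMean
  rw [Finset.sum_powerset_insert ha, Finset.mul_sum, Finset.mul_sum]
  congr 1
  · refine Finset.sum_congr rfl fun N hN => ?_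
    have haN : a ∉ N := fun h => ha (Finset.mem_powerset.1 hN h)
    rw [Finset.prod_insert ha, if_neg haN, mul_assoc]
  · refine Finset.sum_congr rfl fun N hN => ?_
    rw [Finset.prod_insert ha, if_pos (Finset.mem_insert_self a N), mul_assoc]
    congr 2
    refine Finset.prod_congr rfl fun v hv => ?_
    have hva : v ≠ a := fun h => ha (h ▸ hv)
    simp [hva]

theorem coinMean_const (s : Finset V) (q : V → ℝ) (x : ℝ) : coinMean s q (fun _ => x) = x := by
  induction s using Finset.induction_on with
  | empty => simp
  | insert a s ha ih => rw [coinMean_insert ha, ih]; ring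

theorem coinMean_sub (s : Finset V) (q : V → ℝ) (h k : Finset V → ℝ) :
    coinMean s q (fun N => h N - k N) = coinMean s q h - coinMean s q k := by
  simp [coinMean, mul_sub, Finset.sum_sub_distrib]

theorem coinMean_mono {s : Finset V} {q : V → ℝ} (hq : ∀ v, 0 ≤ q v ∧ q v ≤ 1)
    {h k : Finset V → ℝ} (hhk : ∀ N, (∀ v ∈ N, q v ≠ 0) → h N ≤ k N) :
    coinMean s q h ≤ coinMean s q k := by
  refine Finset.sum_le_sum fun N hN => ?_
  by_cases hN' : ∀ v ∈ N, q v ≠ 0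
  · refine mul_le_mul_of_nonneg_left (hhk N hN') (Finset.prod_nonneg fun v _ => ?_)
    split_ifs
    · exact (hq v).1
    · linarith [(hq v).2]
  · push Not at hN'
    obtain ⟨v, hv, hv0⟩ := hN'
    have : (∏ v ∈ s, if v ∈ N then q v else 1 - q v) = 0 :=
      Finset.prod_eq_zero (Finset.mem_powerset.1 hN hv) (by simp [hv, hv0])
    simp [this]

theorem coinMean_congr {s : Finset V} {q : V → ℝ} (hq : ∀ v, 0 ≤ q v ∧ q v ≤ 1)
    {h k : Finset V → ℝ} (hhk : ∀ N, (∀ v ∈ N, q v ≠ 0) → h N = k N) :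
    coinMean s q h = coinMean s q k :=
  le_antisymm (coinMean_mono hq fun N hN => (hhk N hN).le)
    (coinMean_mono hq fun N hN => (hhk N hN).ge)

/-- Coins that must not count may have success probability zero, or be tossed and then ignored. -/
theorem coinMean_ite (s : Finset V) (P : V → Prop) [DecidablePred P] (q : V → ℝ)
    (h : Finset V → ℝ) :
    coinMean s (fun v => if P v then q v else 0) h = coinMean s q fun N => h (N.filter P) := by
  induction s using Finset.induction_on generalizing h with
  | empty => simp
  | insert a s ha ih =>
    rw [coinMean_insert ha, coinMean_insert ha, ih, ih]
    by_cases hPa : P a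
    · simp [hPa, Finset.filter_insert]
    · simp [hPa, Finset.filter_insert]
      ring

/-- Tossing two independent families of coins amounts to tossing one family, whose failure
probabilities are the products. -/
theorem coinMean_union (s : Finset V) (q q' : V → ℝ) (h : Finset V → ℝ) :
    coinMean s (fun v => 1 - (1 - q v) * (1 - q' v)) h =
      coinMean s q fun N => coinMean s q' fun R => h (N ∪ R) := by
  have hadd : ∀ (t : Finset V) (x y : ℝ) (k l : Finset V → ℝ),
      coinMean t q (fun N => x * k N + y * l N) = x * coinMean t q k + y * coinMean t q l := by
    intro t x y k l
    simp only [coinMean, Finset.mul_sum, ← Finset.sum_add_distrib]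
    exact Finset.sum_congr rfl fun N _ => by ring
  induction s using Finset.induction_on generalizing h with
  | empty => simp
  | insert a s ha ih =>
    simp only [coinMean_insert ha, hadd, ih, Finset.insert_union, Finset.union_insert,
      Finset.insert_idem]
    ring

/-- Monotone coupling of two families of independent coins: outside `K`, every coin `q' v` is at
most as likely to succeed as `q v`, so that the successes of `q'` can be assumed to lie in `K` or
among the successes of `q`. -/
theorem coinMean_le_of_dominated {s : Finset V} {q q' : V → ℝ} (hq : ∀ v, 0 ≤ q v ∧ q v ≤ 1)
    (hq' : ∀ v, 0 ≤ q' v ∧ q' v ≤ 1) {K : Set V} (hK : ∀ v, v ∉ K → q' v ≤ q v)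
    {h h' : Finset V → ℝ}
    (hh : ∀ N N', (∀ v ∈ N, q v ≠ 0) → (∀ v ∈ N', q' v ≠ 0) → (∀ v ∈ N', v ∈ N ∨ v ∈ K) →
      h' N' ≤ h N) :
    coinMean s q' h' ≤ coinMean s q h := by
  induction s using Finset.induction_on generalizing h h' with
  | empty => simpa using hh ∅ ∅ (by simp) (by simp) (by simp)
  | insert a s ha ih =>
    rw [coinMean_insert ha, coinMean_insert ha]
    obtain ⟨h0, h1⟩ := hq a
    obtain ⟨h0', h1'⟩ := hq' a
    have hxX : coinMean s q' h' ≤ coinMean s q h := ih hh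
    have hxY : q a ≠ 0 → coinMean s q' h' ≤ coinMean s q fun N => h (insert a N) := fun ne =>
      ih fun N N' hN hN' hNN' => hh _ _ (by simpa [ne] using hN) hN' fun v hv =>
        (hNN' v hv).imp_left Finset.mem_insert_of_mem
    have hyY : q a ≠ 0 → q' a ≠ 0 → coinMean s q' (fun N => h' (insert a N)) ≤
        coinMean s q fun N => h (insert a N) := fun ne ne' =>
      ih fun N N' hN hN' hNN' => hh _ _ (by simpa [ne] using hN) (by simpa [ne'] using hN')
        fun v hv => by
          rcases Finset.mem_insert.1 hv with rfl | hv
          · simp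
          · exact (hNN' v hv).imp_left Finset.mem_insert_of_mem
    have hyX : a ∈ K → q' a ≠ 0 → coinMean s q' (fun N => h' (insert a N)) ≤ coinMean s q h :=
      fun haK ne' => ih fun N N' hN hN' hNN' => hh _ _ hN (by simpa [ne'] using hN')
        fun v hv => by
          rcases Finset.mem_insert.1 hv with rfl | hv
          · exact Or.inr haK
          · exact hNN' v hv
    have hKa := hK a
    generalize coinMean s q' h' = x at *
    generalize coinMean s q h = X at *
    generalize coinMean s q' (fun N => h' (insert a N)) = y at *
    generalize coinMean s q (fun N => h (insert a N)) = Y at *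
    generalize q a = α at *
    by_cases hα' : q' a = 0
    · rw [hα']
      by_cases hα : α = 0
      · simp [hα, hxX]
      · nlinarith [hxY hα]
    · generalize q' a = β at *
      by_cases hα : α = 0
      · by_cases haK : a ∈ K
        · subst hα
          nlinarith [hyX haK hα']
        · exact absurd (le_antisymm (hα ▸ hKa haK) h0') hα'
      · by_cases haK : a ∈ K
        · have hx : x ≤ (1 - α) * X + α * Y := by nlinarith [hxY hα]
          have hy : y ≤ (1 - α) * X + α * Y := by nlinarith [hyX haK hα', hyY hα hα']
          nlinarith
        · have hle : β ≤ α := hKa haK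
          nlinarith [hxY hα, hyY hα hα', mul_nonneg (sub_nonneg.2 h1) (sub_nonneg.2 hxX),
            mul_nonneg (sub_nonneg.2 hle) (sub_nonneg.2 (hxY hα)),
            mul_nonneg h0' (sub_nonneg.2 (hyY hα hα'))]

theorem coinMean_map {U : Type*} [DecidableEq U] (e : U ↪ V) (s : Finset U) (q : V → ℝ)
    (h : Finset V → ℝ) :
    coinMean (s.map e) q h = coinMean s (fun u => q (e u)) fun N => h (N.map e) := by
  induction s using Finset.induction_on generalizing h with
  | empty => simp
  | insert a s ha ih =>
    rw [Finset.map_insert, coinMean_insert (by simpa using ha), coinMean_insert ha, ih, ih]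
    simp [Finset.map_insert]

end Coins

/-! ### Cascades with pending attempts -/

section Pending

variable {V L : Type*} [DecidableEq L]

/-- The failure probabilities of a decreasing, order independent cascade: `c v D C` is the
probability that the attempts on `v` of all labels in `C` fail, when those in `D` have already
attempted in vain. Only disjoint `D` and `C` matter. -/
structure IsDecreasingFailure (c : V → Finset L → Finset L → ℝ) : Prop where
  nonneg : ∀ v D C, 0 ≤ c v D C
  le_one : ∀ v D C, c v D C ≤ 1
  empty : ∀ v D, c v D ∅ = 1
  union : ∀ v D C C', Disjoint D C → Disjoint (D ∪ C) C' →
    c v D (C ∪ C') = c v D C * c v (D ∪ C) C'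
  mono : ∀ v D D' C, D ⊆ D' → Disjoint D' C → c v D C ≤ c v D' C

/-- The probability that `v` is activated by the attempts of `C`, after those of `D`, where `A` is
the set of active labels. -/
def attemptCoin (ι : V ↪ L) (c : V → Finset L → Finset L → ℝ) (A D C : Finset L) (v : V) : ℝ :=
  if ι v ∈ A then 0 else 1 - c v D C

variable {ι : V ↪ L} {c : V → Finset L → Finset L → ℝ}

theorem attemptCoin_mem (hc : IsDecreasingFailure c) (A D C : Finset L) (v : V) :
    0 ≤ attemptCoin ι c A D C v ∧ attemptCoin ι c A D C v ≤ 1 := by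
  unfold attemptCoin
  have h0 := hc.nonneg v D C
  have h1 := hc.le_one v D C
  split_ifs <;> constructor <;> linarith

theorem disjoint_map_of_attemptCoin_ne_zero {A D C : Finset L} {N : Finset V}
    (hN : ∀ v ∈ N, attemptCoin ι c A D C v ≠ 0) : Disjoint A (N.map ι) := by
  rw [Finset.disjoint_right]
  intro x hx hxA
  obtain ⟨v, hv, rfl⟩ := Finset.mem_map.1 hx
  exact hN v hv (by simp [attemptCoin, hxA])

theorem ssubset_union_of_disjoint {D C : Finset L} (hDC : Disjoint D C) (hC : C.Nonempty) :
    D ⊂ D ∪ C := by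
  obtain ⟨x, hx⟩ := hC
  exact Finset.ssubset_iff_of_subset Finset.subset_union_left |>.2
    ⟨x, Finset.mem_union_right _ hx, Finset.disjoint_right.1 hDC hx⟩

variable [Fintype V] [DecidableEq V]

/-- Attempts of `C ∪ C'` may be made in two rounds, those of `C'` only on the nodes that `C` has
failed to activate. -/
theorem coinMean_attemptCoin_union (hc : IsDecreasingFailure c) {A D C C' : Finset L}
    (hDC : Disjoint D C) (hDC' : Disjoint (D ∪ C) C') (h : Finset V → ℝ) :
    coinMean Finset.univ (attemptCoin ι c A D (C ∪ C')) h =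
      coinMean Finset.univ (attemptCoin ι c A D C) fun N =>
        coinMean Finset.univ (attemptCoin ι c (A ∪ N.map ι) (D ∪ C) C') fun N' =>
          h (N ∪ N') := by
  have h1 : attemptCoin ι c A D (C ∪ C') = fun v =>
      1 - (1 - attemptCoin ι c A D C v) * (1 - attemptCoin ι c A (D ∪ C) C' v) := by
    funext v
    unfold attemptCoin
    split_ifs
    · simp
    · rw [hc.union v D C C' hDC hDC']; ring
  rw [h1, coinMean_union]
  congr 1
  funext N
  have h2 : attemptCoin ι c (A ∪ N.map ι) (D ∪ C) C' = fun v =>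
      if v ∉ N then attemptCoin ι c A (D ∪ C) C' v else 0 := by
    funext v
    by_cases hA : ι v ∈ A <;> by_cases hN : v ∈ N <;> simp [attemptCoin, hA, hN]
  rw [h2, coinMean_ite]
  congr 1
  funext R
  congr 1
  ext v
  by_cases hN : v ∈ N <;> simp [hN]

/-- The mean of `g X`, where `X` is the final set of active labels, when those of `D` have made
their attempts and those of `C` are contagious. An activated node `v` contributes its label `ι v`;
labels outside the range of `ι` act as sources, which can never be activated. -/
def finalMean [Fintype L] (ι : V ↪ L) (c : V → Finset L → Finset L → ℝ) (g : Finset L → ℝ)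
    (D C : Finset L) : ℝ :=
  if _h : C ⊆ D then g D
  else coinMean Finset.univ (attemptCoin ι c (D ∪ C) D C) fun N =>
    finalMean ι c g (D ∪ C) (N.map ι)
termination_by Dᶜ.card
decreasing_by
  refine Finset.card_lt_card (Finset.compl_ssubset_compl.2 ?_)
  exact Finset.ssubset_iff_subset_ne.2 ⟨Finset.subset_union_left,
    fun h => _h (h ▸ Finset.subset_union_right)⟩

variable [Fintype L]

theorem finalMean_empty (g : Finset L → ℝ) (D : Finset L) : finalMean ι c g D ∅ = g D := by
  rw [finalMean]
  simp

theorem finalMean_step (hc : IsDecreasingFailure c) (g : Finset L → ℝ) {D C : Finset L}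
    (hDC : Disjoint D C) :
    finalMean ι c g D C = coinMean Finset.univ (attemptCoin ι c (D ∪ C) D C) fun N =>
      finalMean ι c g (D ∪ C) (N.map ι) := by
  by_cases h : C ⊆ D
  · obtain rfl : C = ∅ := by
      rw [← Finset.disjoint_self_iff_empty]
      exact hDC.mono_left h
    rw [finalMean_empty, ← coinMean_const Finset.univ (attemptCoin ι c (D ∪ ∅) D ∅) (g D)]
    refine coinMean_congr (attemptCoin_mem hc _ _ _) fun N hN => ?_
    obtain rfl : N = ∅ := Finset.eq_empty_of_forall_notMem fun v hv => hN v hv (by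
      simp [attemptCoin, hc.empty])
    simp [finalMean_empty]
  · rw [finalMean, dif_neg h]

/-- The attempts of a part `C'` of the contagious labels can be delayed by one round: this does not
change the law of the final active set. -/
theorem finalMean_delay (hc : IsDecreasingFailure c) (g : Finset L → ℝ) {D C C' : Finset L}
    (hDC : Disjoint D C) (hDC' : Disjoint (D ∪ C) C') :
    finalMean ι c g D (C ∪ C') =
      coinMean Finset.univ (attemptCoin ι c (D ∪ C ∪ C') D C) fun N =>
        finalMean ι c g (D ∪ C) (C' ∪ N.map ι) := by
  induction D using WellFoundedGT.induction generalizing C C' with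
  | ind D ih =>
  rcases (C ∪ C').eq_empty_or_nonempty with h0 | hne
  · obtain ⟨rfl, rfl⟩ := Finset.union_eq_empty.1 h0
    simp only [Finset.union_empty, Finset.empty_union]
    simpa using finalMean_step hc g (Finset.disjoint_empty_right D)
  have hD : Disjoint D (C ∪ C') := by
    rw [Finset.disjoint_union_right]
    exact ⟨hDC, hDC'.mono_left Finset.subset_union_left⟩
  rw [finalMean_step hc g hD, ← Finset.union_assoc, coinMean_attemptCoin_union hc hDC hDC']
  refine coinMean_congr (attemptCoin_mem hc _ _ _) fun N hN => ?_
  have hN := disjoint_map_of_attemptCoin_ne_zero hN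
  have hN1 : Disjoint (D ∪ C) (C' ∪ N.map ι) := by
    rw [Finset.disjoint_union_right]
    exact ⟨hDC', hN.mono_left Finset.subset_union_left⟩
  rw [finalMean_step hc g hN1, coinMean_attemptCoin_union hc hDC' hN, ← Finset.union_assoc]
  refine coinMean_congr (attemptCoin_mem hc _ _ _) fun N' hN' => ?_
  have hN' := disjoint_map_of_attemptCoin_ne_zero hN'
  rw [Finset.map_union, ih _ (by
    rw [Finset.union_assoc]; exact ssubset_union_of_disjoint hD hne) hN hN']
  simp only [Finset.map_union]

/-- Values of `finalMean` are compared by comparing the functions on the possible final sets: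
these contain `D ∪ C`, and no sources outside `D ∪ C`. -/
theorem finalMean_mono (hc : IsDecreasingFailure c) {g g' : Finset L → ℝ} {D C : Finset L}
    (hgg : ∀ X, D ∪ C ⊆ X → (∀ x ∈ X, x ∉ Set.range ι → x ∈ D ∪ C) → g X ≤ g' X) :
    finalMean ι c g D C ≤ finalMean ι c g' D C := by
  induction D using WellFoundedGT.induction generalizing C with
  | ind D ih =>
  by_cases h : C ⊆ D
  · rw [finalMean, finalMean, dif_pos h, dif_pos h]
    refine hgg D (Finset.union_subset le_rfl h) fun x hx _ => Finset.mem_union_left _ hx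
  · rw [finalMean, finalMean, dif_neg h, dif_neg h]
    refine coinMean_mono (attemptCoin_mem hc _ _ _) fun N _ => ih _ ?_ fun X hX hX' => ?_
    · exact Finset.ssubset_iff_subset_ne.2 ⟨Finset.subset_union_left,
        fun h' => h (h' ▸ Finset.subset_union_right)⟩
    · refine hgg X (Finset.subset_union_left.trans hX) fun x hx hxι => ?_
      refine (Finset.mem_union.1 (hX' x hx hxι)).resolve_right fun hxN => hxι ?_
      obtain ⟨v, -, rfl⟩ := Finset.mem_map.1 hxN
      exact ⟨v, rfl⟩

theorem finalMean_const (x : ℝ) (D C : Finset L) : finalMean ι c (fun _ => x) D C = x := by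
  induction D using WellFoundedGT.induction generalizing C with
  | ind D ih =>
  by_cases h : C ⊆ D
  · rw [finalMean, dif_pos h]
  · have hD : D < D ∪ C := Finset.ssubset_iff_subset_ne.2 ⟨Finset.subset_union_left,
        fun h' => h (h' ▸ Finset.subset_union_right)⟩
    rw [finalMean, dif_neg h]
    simp only [ih _ hD, coinMean_const]

theorem finalMean_sub (g g' : Finset L → ℝ) (D C : Finset L) :
    finalMean ι c (fun X => g X - g' X) D C = finalMean ι c g D C - finalMean ι c g' D C := by
  induction D using WellFoundedGT.induction generalizing C with
  | ind D ih =>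
  by_cases h : C ⊆ D
  · rw [finalMean, finalMean, finalMean, dif_pos h, dif_pos h, dif_pos h]
  · have hD : D < D ∪ C := Finset.ssubset_iff_subset_ne.2 ⟨Finset.subset_union_left,
        fun h' => h (h' ▸ Finset.subset_union_right)⟩
    rw [finalMean, finalMean, finalMean, dif_neg h, dif_neg h, dif_neg h]
    simp only [ih _ hD, coinMean_sub]

/-- Sources can be held back until the cascade of the other contagious labels has ended. -/
theorem finalMean_union_sources (hc : IsDecreasingFailure c) (g : Finset L → ℝ)
    {D C R : Finset L} (hDC : Disjoint D C) (hR : Disjoint (D ∪ C) R)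
    (hRι : ∀ x ∈ R, x ∉ Set.range ι) :
    finalMean ι c g D (C ∪ R) = finalMean ι c (fun X => finalMean ι c g X R) D C := by
  induction D using WellFoundedGT.induction generalizing C with
  | ind D ih =>
  rcases C.eq_empty_or_nonempty with rfl | hne
  · rw [Finset.empty_union, finalMean_empty]
  rw [finalMean_delay hc g hDC hR, finalMean_step hc _ hDC]
  have hcoin : attemptCoin ι c (D ∪ C ∪ R) D C = attemptCoin ι c (D ∪ C) D C := by
    funext v
    have hv : ι v ∉ R := fun h => hRι _ h ⟨v, rfl⟩
    simp [attemptCoin, hv]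
  rw [hcoin]
  refine coinMean_congr (attemptCoin_mem hc _ _ _) fun N hN => ?_
  rw [Finset.union_comm R]
  refine ih _ (ssubset_union_of_disjoint hDC hne) (disjoint_map_of_attemptCoin_ne_zero hN) ?_
  rw [Finset.disjoint_union_left]
  refine ⟨hR, Finset.disjoint_left.2 fun x hx hxR => hRι x hxR ?_⟩
  obtain ⟨v, -, rfl⟩ := Finset.mem_map.1 hx
  exact ⟨v, rfl⟩

/-- The mean additional weight activated by contagious labels decreases when more labels have
already made their attempts, and when fewer labels are contagious. The cascade from `(D, C)` is
compared with the one from `(D', C')` after delaying the attempts of `C \ C'`. -/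
theorem finalMean_gain_le (hc : IsDecreasingFailure c) {w : L → ℝ} (hw : ∀ x, 0 ≤ w x)
    {D D' C C' : Finset L} (hD : D ⊆ D') (hC : C' ⊆ C) (hDC : Disjoint D C)
    (hDC' : Disjoint D' C') :
    finalMean ι c (fun X => ∑ x ∈ X, w x) D' C' - ∑ x ∈ D', w x ≤
      finalMean ι c (fun X => ∑ x ∈ X, w x) D C - ∑ x ∈ D, w x := by
  induction D' using WellFoundedGT.induction generalizing D C C' with
  | ind D' ih =>
  rcases C'.eq_empty_or_nonempty with rfl | hne
  · rw [finalMean_empty, sub_self, sub_nonneg,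
      ← finalMean_const (ι := ι) (c := c) (∑ x ∈ D, w x) D C]
    refine finalMean_mono hc fun X hX _ => ?_
    exact Finset.sum_le_sum_of_subset_of_nonneg (Finset.subset_union_left.trans hX)
      fun x _ _ => hw x
  have hDC1 : Disjoint D C' := hDC'.mono_left hD
  have hDC2 : Disjoint (D ∪ C') (C \ C') := by
    rw [Finset.disjoint_union_left]
    exact ⟨hDC.mono_right Finset.sdiff_subset, Finset.disjoint_sdiff⟩
  have hCC : C = C' ∪ C \ C' := (Finset.union_sdiff_of_subset hC).symm
  have hstep : finalMean ι c (fun X => ∑ x ∈ X, w x) D C =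
      coinMean Finset.univ (attemptCoin ι c (D ∪ C) D C') fun N =>
        finalMean ι c (fun X => ∑ x ∈ X, w x) (D ∪ C') (C \ C' ∪ N.map ι) := by
    conv_lhs => rw [hCC]
    rw [finalMean_delay hc _ hDC1 hDC2, Finset.union_assoc, ← hCC]
  rw [hstep, finalMean_step hc _ hDC',
    ← coinMean_const Finset.univ (attemptCoin ι c (D' ∪ C') D' C') (∑ x ∈ D', w x),
    ← coinMean_const Finset.univ (attemptCoin ι c (D ∪ C) D C') (∑ x ∈ D, w x),
    ← coinMean_sub, ← coinMean_sub]
  refine coinMean_le_of_dominated (K := {v | ι v ∈ C \ C'}) (attemptCoin_mem hc _ _ _)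
    (attemptCoin_mem hc _ _ _) (fun v hv => ?_) fun N N' hN hN' hNN' => ?_
  · -- outside `C \ C'`, the nodes open to attempts in `(D', C')` are also open in `(D, C)`
    by_cases hvA : ι v ∈ D' ∪ C'
    · rw [attemptCoin, if_pos hvA]
      exact (attemptCoin_mem hc _ _ _ v).1
    · have hvA' : ι v ∉ D ∪ C := by
        simp only [Finset.mem_union, Set.mem_ofPred_eq, Finset.mem_sdiff, not_or, not_and,
          not_not] at hv hvA ⊢
        exact ⟨fun h => hvA.1 (hD h), fun h => hvA.2 (hv h)⟩
      rw [attemptCoin, attemptCoin, if_neg hvA, if_neg hvA']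
      linarith [hc.mono v D D' C' hD hDC']
  · have hN := disjoint_map_of_attemptCoin_ne_zero hN
    have hN' := disjoint_map_of_attemptCoin_ne_zero hN'
    have key := ih (D' ∪ C') (ssubset_union_of_disjoint hDC' hne) (D := D ∪ C')
      (C := C \ C' ∪ N.map ι) (C' := N'.map ι) (Finset.union_subset_union_left hD) ?_ ?_ hN'
    · rw [Finset.sum_union hDC1, Finset.sum_union hDC'] at key
      linarith
    · intro x hx
      obtain ⟨v, hv, rfl⟩ := Finset.mem_map.1 hx
      rcases hNN' v hv with h | h
      · exact Finset.mem_union_right _ (Finset.mem_map_of_mem ι h)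
      · exact Finset.mem_union_left _ h
    · rw [Finset.disjoint_union_right]
      exact ⟨hDC2, hN.mono_left (Finset.union_subset_union_right hC)⟩

/-- The gain of an additional source `s` is the mean, over the final active set `X` of the cascade
without `s`, of the weight that `s` activates when it starts from `X`. -/
theorem finalMean_insert_source_sub (hc : IsDecreasingFailure c) (g : Finset L → ℝ) {A : Finset L}
    {s : L} (hs : s ∉ A) (hsι : s ∉ Set.range ι) :
    finalMean ι c g ∅ (insert s A) - finalMean ι c g ∅ A =
      finalMean ι c (fun X => finalMean ι c g X {s} - g X) ∅ A := by
  rw [finalMean_sub, Finset.insert_eq, Finset.union_comm, finalMean_union_sources hc g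
    (Finset.disjoint_empty_left A) (by simpa using hs) (by simpa using hsι)]

/-- The mean weight of the final active set increases with the set of sources. -/
theorem finalMean_le_insert_source (hc : IsDecreasingFailure c) {w : L → ℝ} (hw : ∀ x, 0 ≤ w x)
    {A : Finset L} {s : L} (hs : s ∉ A) (hsι : s ∉ Set.range ι) :
    finalMean ι c (fun X => ∑ x ∈ X, w x) ∅ A ≤
      finalMean ι c (fun X => ∑ x ∈ X, w x) ∅ (insert s A) := by
  rw [← sub_nonneg, finalMean_insert_source_sub hc _ hs hsι,
    ← finalMean_const (ι := ι) (c := c) 0 ∅ A]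
  refine finalMean_mono hc fun X _ _ => ?_
  rw [sub_nonneg, ← finalMean_const (ι := ι) (c := c) (∑ x ∈ X, w x) X {s}]
  exact finalMean_mono hc fun Y hY _ => Finset.sum_le_sum_of_subset_of_nonneg
    (Finset.subset_union_left.trans hY) fun x _ _ => hw x

/-- The mean weight of the final active set is a submodular function of the set of sources. -/
theorem finalMean_insert_source_sub_le (hc : IsDecreasingFailure c) {w : L → ℝ}
    (hw : ∀ x, 0 ≤ w x) {A A' : Finset L} (hA : A ⊆ A') (hAι : ∀ x ∈ A', x ∉ Set.range ι) {s : L}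
    (hs : s ∉ A') (hsι : s ∉ Set.range ι) :
    finalMean ι c (fun X => ∑ x ∈ X, w x) ∅ (insert s A') -
        finalMean ι c (fun X => ∑ x ∈ X, w x) ∅ A' ≤
      finalMean ι c (fun X => ∑ x ∈ X, w x) ∅ (insert s A) -
        finalMean ι c (fun X => ∑ x ∈ X, w x) ∅ A := by
  have hsA : s ∉ A := fun h => hs (hA h)
  rw [finalMean_insert_source_sub hc _ hs hsι, finalMean_insert_source_sub hc _ hsA hsι]
  conv_lhs => rw [← Finset.union_sdiff_of_subset hA]
  rw [finalMean_union_sources hc _ (Finset.disjoint_empty_left A)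
    (by simpa using Finset.disjoint_sdiff) fun x hx => hAι x (Finset.mem_sdiff.1 hx).1]
  refine finalMean_mono hc fun X _ hX => ?_
  set G := fun Y => finalMean ι c (fun X => ∑ x ∈ X, w x) Y {s} - ∑ x ∈ Y, w x
  change finalMean ι c G X (A' \ A) ≤ G X
  rw [← finalMean_const (ι := ι) (c := c) (G X) X (A' \ A)]
  refine finalMean_mono hc fun Y hY hY' => ?_
  have hsX : s ∉ X := fun h => by simpa [hsA] using hX s h hsι
  have hsY : s ∉ Y := fun h => by simpa [hsX, hs] using hY' s h hsι
  exact finalMean_gain_le hc hw (Finset.subset_union_left.trans hY) le_rfl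
    (by simpa using hsX) (by simpa using hsY)

end Pending

/-! ### Means with respect to the laws of the model -/

section Means

variable {α β : Type*} [Fintype α] [Fintype β]

/-- The mean of `f` with respect to a probability mass function on a finite type. -/
def pmfMean (μ : PMF α) (f : α → ℝ) : ℝ := ∑ x, (μ x).toReal * f x

theorem pmfMean_pure (a : α) (f : α → ℝ) : pmfMean (PMF.pure a) f = f a := by
  classical
  simp only [pmfMean, PMF.pure_apply]
  rw [Finset.sum_eq_single a (fun b _ hb => by simp [hb]) (by simp)]
  simp

theorem pmfMean_bind (μ : PMF α) (ν : α → PMF β) (f : β → ℝ) :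
    pmfMean (μ.bind ν) f = pmfMean μ fun a => pmfMean (ν a) f := by
  simp only [pmfMean, PMF.bind_apply, tsum_fintype]
  simp_rw [Finset.mul_sum]
  rw [Finset.sum_comm]
  refine Finset.sum_congr rfl fun b _ => ?_
  rw [ENNReal.toReal_sum fun a _ => ENNReal.mul_ne_top (PMF.apply_ne_top _ _)
    (PMF.apply_ne_top _ _), Finset.sum_mul]
  exact Finset.sum_congr rfl fun a _ => by rw [ENNReal.toReal_mul, mul_assoc]

theorem pmfMean_map (μ : PMF α) (φ : α → β) (f : β → ℝ) :
    pmfMean (μ.map φ) f = pmfMean μ fun a => f (φ a) := by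
  rw [PMF.map, pmfMean_bind]
  simp [pmfMean_pure]

theorem pmfMean_indepCoins [DecidableEq α] (q : α → I) (h : Finset α → ℝ) :
    pmfMean (indepCoins q) h = coinMean Finset.univ (fun v => (q v : ℝ)) h := by
  unfold pmfMean coinMean
  rw [Finset.powerset_univ]
  refine Finset.sum_congr rfl fun N _ => ?_
  congr 1
  change (coinWeight q N).toReal = _
  rw [coinWeight, ENNReal.toReal_prod]
  refine Finset.prod_congr rfl fun v _ => ?_
  split_ifs
  · exact ENNReal.toReal_ofReal (q v).2.1
  · exact ENNReal.toReal_ofReal (by linarith [(q v).2.2])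

/-- A state is a pair of sets of nodes, so that means over states are finite sums. -/
instance : Fintype (CascadeState α) :=
  Fintype.ofEquiv (Finset α × Finset α)
    ⟨fun x => ⟨x.1, x.2⟩, fun s => (s.active, s.contagious), fun _ => rfl, fun _ => rfl⟩

end Means

/-! ### Failure probabilities of successive attempts -/

section FailProb

variable {W : Type*} [DecidableEq W] {p : W → W → Finset W → I}

theorem failProb_append (v : W) (S : Finset W) (l l' : List W) :
    failProb p v S (l ++ l') = failProb p v S l * failProb p v (S ∪ l.toFinset) l' := by
  induction l generalizing S with
  | nil => simp [failProb]
  | cons u l ih =>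
    rw [List.cons_append, failProb, failProb, ih, mul_assoc, List.toFinset_cons,
      Finset.union_insert, Finset.insert_union]

theorem failProb_mono [Fintype W] {G : Digraph W} (hdec : IsDecreasing G p) {v : W}
    {S T : Finset W} {l : List W} (hST : S ⊆ T) (hT : T ⊆ inNbrs G v)
    (hl : ∀ u ∈ l, u ∈ inNbrs G v ∧ u ∉ T) (hnd : l.Nodup) :
    failProb p v S l ≤ failProb p v T l := by
  induction l generalizing S T with
  | nil => simp [failProb]
  | cons u l ih =>
    obtain ⟨hu, hl⟩ := List.forall_mem_cons.1 hl
    obtain ⟨hul, hnd⟩ := List.nodup_cons.1 hnd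
    rw [failProb, failProb]
    refine mul_le_mul' (unitInterval.symm_le_symm.2 (hdec v u S T hST hT hu.1 hu.2)) ?_
    refine ih (Finset.insert_subset_insert u hST) (Finset.insert_subset hu.1 hT)
      (fun x hx => ⟨(hl x hx).1, ?_⟩) hnd
    rw [Finset.mem_insert, not_or]
    exact ⟨fun h => hul (h ▸ hx), (hl x hx).2⟩

theorem failProb_congr [Fintype W] {G : Digraph W} (hord : IsOrderIndependent G p) {v : W}
    {S : Finset W} {l l' : List W} (hS : S ⊆ inNbrs G v)
    (hl : ∀ u ∈ l, u ∈ inNbrs G v ∧ u ∉ S) (hnd : l.Nodup) (hnd' : l'.Nodup)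
    (hll : ∀ u, u ∈ l ↔ u ∈ l') :
    failProb p v S l = failProb p v S l' :=
  hord v S l l' hS hl hnd ((List.perm_ext_iff_of_nodup hnd hnd').2 hll)

end FailProb

/-! ### The follow-back cascade as a cascade with sources -/

section Labels

variable {V : Type*} [DecidableEq V]

/-- The labels in `V ⊕ V` that stand for a set of nodes, when `F` is the set of followers of `u₀`:
`Sum.inl u` stands for the user `u`, and `Sum.inr v` for `u₀` in its role as a possible influence
on `v` only. -/
def nodeLabels (F : Finset V) (X : Finset (Option V)) : Finset (V ⊕ V) :=
  X.eraseNone.disjSum (if none ∈ X then F else ∅)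

theorem inl_mem_nodeLabels {F : Finset V} {X : Finset (Option V)} {u : V} :
    Sum.inl u ∈ nodeLabels F X ↔ some u ∈ X := by
  simp [nodeLabels]

theorem inr_mem_nodeLabels {F : Finset V} {X : Finset (Option V)} {v : V} :
    Sum.inr v ∈ nodeLabels F X ↔ none ∈ X ∧ v ∈ F := by
  by_cases h : none ∈ X <;> simp [nodeLabels, h]

theorem nodeLabels_empty (F : Finset V) : nodeLabels F ∅ = ∅ := by
  simp [nodeLabels]

theorem nodeLabels_union (F : Finset V) (X Y : Finset (Option V)) :
    nodeLabels F (X ∪ Y) = nodeLabels F X ∪ nodeLabels F Y := by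
  ext (u | v)
  · simp [inl_mem_nodeLabels]
  · simp only [inr_mem_nodeLabels, Finset.mem_union]
    tauto

theorem nodeLabels_disjoint (F : Finset V) {X Y : Finset (Option V)} (h : Disjoint X Y) :
    Disjoint (nodeLabels F X) (nodeLabels F Y) := by
  rw [Finset.disjoint_left] at h ⊢
  rintro (u | v) hX hY
  · exact h (inl_mem_nodeLabels.1 hX) (inl_mem_nodeLabels.1 hY)
  · exact h (inr_mem_nodeLabels.1 hX).1 (inr_mem_nodeLabels.1 hY).1

theorem nodeLabels_map_some (F N : Finset V) :
    nodeLabels F (N.map Function.Embedding.some) = N.map Function.Embedding.inl := by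
  ext (u | v)
  · simp [inl_mem_nodeLabels]
  · simp [inr_mem_nodeLabels]

theorem nodeLabels_singleton_none (F : Finset V) :
    nodeLabels F {none} = F.map Function.Embedding.inr := by
  ext (u | v)
  · simp [inl_mem_nodeLabels]
  · simp [inr_mem_nodeLabels]

variable [Fintype V]

/-- The label of an in-neighbour of `v`. -/
def arcLabel (v : V) : Option V → V ⊕ V
  | some u => Sum.inl u
  | none => Sum.inr v

open Classical in
/-- The potential in-neighbours of `v` whose label is in `D`. -/
def attempters (E : Digraph V) (v : V) (D : Finset (V ⊕ V)) : Finset (Option V) :=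
  {x ∈ inNbrs (tweetGraph E Finset.univ) (some v) | arcLabel v x ∈ D}

/-- The probability that the attempts on `v` of the nodes with labels in `C` all fail, when those
with labels in `D` have attempted in vain. -/
def followBackFailure (E : Digraph V) (p : Option V → Option V → Finset (Option V) → I) (v : V)
    (D C : Finset (V ⊕ V)) : ℝ :=
  failProb p (some v) (attempters E v D) (attempters E v C).toList

variable {E : Digraph V} {p : Option V → Option V → Finset (Option V) → I}

theorem mem_attempters {v : V} {D : Finset (V ⊕ V)} {x : Option V} :
    x ∈ attempters E v D ↔
      x ∈ inNbrs (tweetGraph E Finset.univ) (some v) ∧ arcLabel v x ∈ D := by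
  simp [attempters]

theorem mem_inNbrs {W : Type*} [Fintype W] {G : Digraph W} {u v : W} :
    u ∈ inNbrs G v ↔ G.Adj u v := by
  simp only [inNbrs, Finset.mem_filter, Finset.mem_univ, true_and]

theorem attempters_subset (v : V) (D : Finset (V ⊕ V)) :
    attempters E v D ⊆ inNbrs (tweetGraph E Finset.univ) (some v) :=
  fun _ hx => (mem_attempters.1 hx).1

theorem attempters_union (v : V) (C D : Finset (V ⊕ V)) :
    attempters E v (C ∪ D) = attempters E v C ∪ attempters E v D := by
  ext x
  simp only [mem_attempters, Finset.mem_union]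
  tauto

theorem notMem_attempters_of_disjoint {v : V} {C D : Finset (V ⊕ V)} (h : Disjoint D C)
    {x : Option V} (hx : x ∈ attempters E v C) : x ∉ attempters E v D := fun hx' =>
  Finset.disjoint_left.1 h (mem_attempters.1 hx').2 (mem_attempters.1 hx).2

theorem isDecreasingFailure_followBackFailure
    (hdec : IsDecreasing (tweetGraph E Finset.univ) p)
    (hord : IsOrderIndependent (tweetGraph E Finset.univ) p) :
    IsDecreasingFailure (followBackFailure E p) where
  nonneg v D C := (failProb p _ _ _).2.1
  le_one v D C := (failProb p _ _ _).2.2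
  empty v D := by simp [followBackFailure, attempters, failProb]
  union v D C C' hDC hDC' := by
    have h := failProb_congr hord (v := some v) (S := attempters E v D)
      (l := (attempters E v (C ∪ C')).toList)
      (l' := (attempters E v C).toList ++ (attempters E v C').toList)
      (attempters_subset v D) ?_ (Finset.nodup_toList _) ?_ (by simp [attempters_union])
    · rw [followBackFailure, h, failProb_append, Finset.toList_toFinset, ← attempters_union]
      rfl
    · intro u hu
      rw [Finset.mem_toList] at hu
      refine ⟨attempters_subset v _ hu, notMem_attempters_of_disjoint ?_ hu⟩
      exact Finset.disjoint_union_right.2 ⟨hDC, (Finset.disjoint_union_left.1 hDC').1⟩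
    · refine (Finset.nodup_toList _).append (Finset.nodup_toList _) fun u hu hu' => ?_
      rw [Finset.mem_toList] at hu hu'
      exact notMem_attempters_of_disjoint (Finset.disjoint_union_left.1 hDC').2 hu' hu
  mono v D D' C hD hC := by
    refine failProb_mono hdec (fun x hx => ?_) (attempters_subset v D') (fun u hu => ?_)
      (Finset.nodup_toList _)
    · rw [mem_attempters] at hx ⊢
      exact ⟨hx.1, hD hx.2⟩
    · rw [Finset.mem_toList] at hu
      exact ⟨attempters_subset v _ hu, notMem_attempters_of_disjoint hC hu⟩

theorem inNbrs_tweetGraph_inter (F : Finset V) (v : V) (X : Finset (Option V)) :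
    inNbrs (tweetGraph E F) (some v) ∩ X = attempters E v (nodeLabels F X) := by
  ext (_ | u)
  · simp [mem_attempters, arcLabel, inr_mem_nodeLabels, mem_inNbrs, tweetGraph, and_comm]
  · simp [mem_attempters, arcLabel, inl_mem_nodeLabels, mem_inNbrs, tweetGraph]

theorem activationProb_some (hord : IsOrderIndependent (tweetGraph E Finset.univ) p)
    (ord : AttemptOrder (Option V)) (F : Finset V) (s : CascadeState (Option V))
    (v : V) :
    (activationProb (tweetGraph E F) p ord s (some v) : ℝ) =
      attemptCoin Function.Embedding.inl (followBackFailure E p) (nodeLabels F s.active)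
        (nodeLabels F (s.active \ s.contagious)) (nodeLabels F s.contagious) v := by
  unfold activationProb attemptCoin
  simp only [Function.Embedding.inl_apply, inl_mem_nodeLabels]
  split_ifs with hv
  · rfl
  · simp only [unitInterval.coe_symm_eq, followBackFailure, inNbrs_tweetGraph_inter]
    congr 2
    refine failProb_congr hord (attempters_subset v _) (fun u hu => ?_) (ord.nodup _ _ _)
      (Finset.nodup_toList _) fun u => by rw [ord.mem_seq, Finset.mem_toList]
    rw [ord.mem_seq] at hu
    exact ⟨attempters_subset v _ hu,
      notMem_attempters_of_disjoint (nodeLabels_disjoint F Finset.sdiff_disjoint) hu⟩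

/-- Along the cascade, once `u₀` is active, the mean of a function of the final active set is
`finalMean` of the current state. The bound on the number `n` of remaining steps leaves room for
the cascade to end. -/
theorem pmfMean_cascadeRun (hdec : IsDecreasing (tweetGraph E Finset.univ) p)
    (hord : IsOrderIndependent (tweetGraph E Finset.univ) p) (ord : AttemptOrder (Option V))
    (F : Finset V) (g : Finset (V ⊕ V) → ℝ) (n : ℕ) (s : CascadeState (Option V))
    (hs : s.contagious ⊆ s.active) (hnone : none ∈ s.active)
    (hn : s.contagious = ∅ ∨ (s.active \ s.contagious)ᶜ.card ≤ n) :
    pmfMean (cascadeRun (tweetGraph E F) p ord n s) (fun t => g (nodeLabels F t.active)) =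
      finalMean Function.Embedding.inl (followBackFailure E p) g
        (nodeLabels F (s.active \ s.contagious)) (nodeLabels F s.contagious) := by
  have hc := isDecreasingFailure_followBackFailure hdec hord
  induction n generalizing s with
  | zero =>
    have hC : s.contagious = ∅ := by
      rcases hn with h | h
      · exact h
      · rw [Nat.le_zero, Finset.card_eq_zero, Finset.compl_eq_empty_iff] at h
        refine Finset.eq_empty_of_forall_notMem fun x hx => ?_
        have := h ▸ Finset.mem_univ x
        exact (Finset.mem_sdiff.1 this).2 hx
    rw [cascadeRun, pmfMean_pure, hC, nodeLabels_empty, finalMean_empty, Finset.sdiff_empty]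
  | succ n ih =>
    have hdisj := nodeLabels_disjoint F (Finset.sdiff_disjoint (s := s.contagious) (t := s.active))
    have hunion : nodeLabels F (s.active \ s.contagious) ∪ nodeLabels F s.contagious =
        nodeLabels F s.active := by
      rw [← nodeLabels_union, Finset.sdiff_union_of_subset hs]
    have huniv : (Finset.univ : Finset (Option V)) =
        insert none (Finset.univ.map Function.Embedding.some) := by
      ext (_ | u) <;> simp
    have hq0 : activationProb (tweetGraph E F) p ord s none = 0 := if_pos hnone
    rw [cascadeRun, pmfMean_bind, cascadeStep, pmfMean_map, pmfMean_indepCoins, huniv,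
      coinMean_insert (by simp), hq0, coinMean_map, finalMean_step hc g hdisj, hunion]
    simp only [Set.Icc.coe_zero, sub_zero, one_mul, zero_mul, add_zero,
      Function.Embedding.some_apply, activationProb_some hord ord F s]
    refine coinMean_congr (attemptCoin_mem hc _ _ _) fun N hN => ?_
    have hNA : Disjoint s.active (N.map Function.Embedding.some) := by
      have := disjoint_map_of_attemptCoin_ne_zero hN
      rw [Finset.disjoint_left] at this ⊢
      intro x hx hxN
      obtain ⟨v, hv, rfl⟩ := Finset.mem_map.1 hxN
      exact this (inl_mem_nodeLabels.2 hx) (Finset.mem_map_of_mem _ hv)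
    have hsd : (s.active ∪ N.map Function.Embedding.some) \ N.map Function.Embedding.some =
        s.active := by
      rw [Finset.union_sdiff_right, Finset.sdiff_eq_self_of_disjoint hNA]
    rw [ih _ Finset.subset_union_right (Finset.mem_union_left _ hnone)]
    · simp only [hsd, nodeLabels_map_some]
    · simp only [hsd]
      by_cases hC : s.contagious = ∅
      · left
        suffices N = ∅ by simp [this]
        refine Finset.eq_empty_of_forall_notMem fun v hv => hN v hv ?_
        simp [attemptCoin, hC, nodeLabels_empty, hc.empty]
      · right
        have hlt : (s.active)ᶜ.card < (s.active \ s.contagious)ᶜ.card :=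
          Finset.card_lt_card (Finset.compl_ssubset_compl.2
            (Finset.sdiff_ssubset hs (Finset.nonempty_iff_ne_empty.2 hC)))
        have := hn.resolve_left hC
        omega

/-- The mean number of retweeting users when exactly the users in `F` follow `u₀`: the sources are
the labels `Sum.inr v`, for `v ∈ F`, and only the labels of users count. -/
def followersValue (E : Digraph V) (p : Option V → Option V → Finset (Option V) → I)
    (F : Finset V) : ℝ :=
  finalMean Function.Embedding.inl (followBackFailure E p)
    (fun X => ∑ x ∈ X, Sum.elim (fun _ => 1) (fun _ => 0) x) ∅ (F.map Function.Embedding.inr)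

/-- The followers in `B` are those of the users that would follow back if asked which lie in `B`,
so that the objective is an average of the functions `B ↦ followersValue E p (B ∩ R)`. -/
theorem expectedRetweets_eq (hdec : IsDecreasing (tweetGraph E Finset.univ) p)
    (hord : IsOrderIndependent (tweetGraph E Finset.univ) p) (r : V → I)
    (ord : AttemptOrder (Option V)) (B : Finset V) :
    expectedRetweets E p r ord B =
      coinMean Finset.univ (fun v => (r v : ℝ)) fun R => followersValue E p {v ∈ R | v ∈ B} := by
  rw [← coinMean_ite]
  change pmfMean (retweeters E p r ord B) (fun C => (C.card : ℝ)) = _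
  rw [retweeters, pmfMean_bind, pmfMean_indepCoins]
  congr 1
  · funext v
    split_ifs <;> rfl
  funext F
  rw [pmfMean_map, finalActive, pmfMean_map, followersValue, ← nodeLabels_singleton_none]
  have h := pmfMean_cascadeRun hdec hord ord F
    (fun X => ∑ x ∈ X, Sum.elim (fun _ => (1 : ℝ)) (fun _ => 0) x) (Fintype.card (Option V))
    ⟨{none}, {none}⟩ le_rfl (Finset.mem_singleton_self _) (Or.inr (Finset.card_le_univ _))
  rw [Finset.sdiff_self, nodeLabels_empty] at h
  rw [← h]
  congr 1
  funext t
  have : t.active.eraseNone = Finset.univ.filter (some · ∈ t.active) := by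
    ext; simp
  simp [nodeLabels, this, Finset.sum_disjSum]

theorem followersValue_le_insert (hdec : IsDecreasing (tweetGraph E Finset.univ) p)
    (hord : IsOrderIndependent (tweetGraph E Finset.univ) p) {F : Finset V} {v : V}
    (hv : v ∉ F) : followersValue E p F ≤ followersValue E p (insert v F) := by
  rw [followersValue, followersValue, Finset.map_insert]
  exact finalMean_le_insert_source (isDecreasingFailure_followBackFailure hdec hord)
    (fun x => by rcases x with x | x <;> simp) (by simpa using hv) (by simp)

theorem followersValue_insert_sub_le (hdec : IsDecreasing (tweetGraph E Finset.univ) p)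
    (hord : IsOrderIndependent (tweetGraph E Finset.univ) p) {F F' : Finset V} (hF : F ⊆ F')
    {v : V} (hv : v ∉ F') :
    followersValue E p (insert v F') - followersValue E p F' ≤
      followersValue E p (insert v F) - followersValue E p F := by
  simp only [followersValue, Finset.map_insert]
  exact finalMean_insert_source_sub_le (isDecreasingFailure_followBackFailure hdec hord)
    (fun x => by rcases x with x | x <;> simp) (Finset.map_subset_map.2 hF) (by simp)
    (by simpa using hv) (by simp)

theorem expectedRetweets_le_insert (hdec : IsDecreasing (tweetGraph E Finset.univ) p)
    (hord : IsOrderIndependent (tweetGraph E Finset.univ) p) (r : V → I)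
    (ord : AttemptOrder (Option V)) (B : Finset V) (v : V) :
    expectedRetweets E p r ord B ≤ expectedRetweets E p r ord (insert v B) := by
  by_cases hv : v ∈ B
  · rw [Finset.insert_eq_of_mem hv]
  rw [expectedRetweets_eq hdec hord, expectedRetweets_eq hdec hord]
  refine coinMean_mono (fun v => (r v).2) fun R _ => ?_
  by_cases hR : v ∈ R
  · have : R.filter (· ∈ insert v B) = insert v (R.filter (· ∈ B)) := by
      ext u
      by_cases huv : u = v <;> simp [huv, hR]
    rw [this]
    exact followersValue_le_insert hdec hord (by simp [hv])
  · have : R.filter (· ∈ insert v B) = R.filter (· ∈ B) := by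
      refine Finset.filter_congr fun u hu => ?_
      have huv : u ≠ v := fun h => hR (h ▸ hu)
      simp [huv]
    rw [this]

/-- The objective of the follow-back problem is submodular. -/
theorem expectedRetweets_insert_sub_le (hdec : IsDecreasing (tweetGraph E Finset.univ) p)
    (hord : IsOrderIndependent (tweetGraph E Finset.univ) p) (r : V → I)
    (ord : AttemptOrder (Option V)) {B B' : Finset V} (hB : B ⊆ B') {v : V} (hv : v ∉ B') :
    expectedRetweets E p r ord (insert v B') - expectedRetweets E p r ord B' ≤
      expectedRetweets E p r ord (insert v B) - expectedRetweets E p r ord B := by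
  simp only [expectedRetweets_eq hdec hord, ← coinMean_sub]
  refine coinMean_mono (fun v => (r v).2) fun R _ => ?_
  by_cases hR : v ∈ R
  · have hins : ∀ A : Finset V, R.filter (· ∈ insert v A) = insert v (R.filter (· ∈ A)) := by
      intro A
      ext u
      by_cases huv : u = v <;> simp [huv, hR]
    rw [hins, hins]
    exact followersValue_insert_sub_le hdec hord
      (Finset.monotone_filter_right R fun u _ hu => hB hu) (by simp [hv])
  · have hins : ∀ A : Finset V, R.filter (· ∈ insert v A) = R.filter (· ∈ A) := by
      refine fun A => Finset.filter_congr fun u hu => ?_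
      have huv : u ≠ v := fun h => hR (h ▸ hu)
      simp [huv]
    rw [hins, hins, sub_self, sub_self]

end Labels

/-! ### The greedy algorithm -/

section Greedy

variable {V : Type*} [DecidableEq V] {f : Finset V → ℝ}

theorem exists_greedyRun [Fintype V] (f : Finset V → ℝ) (K : ℕ) : ∃ B, GreedyRun f K B := by
  induction K with
  | zero => exact ⟨∅, .start⟩
  | succ k ih =>
    obtain ⟨B, hB⟩ := ih
    by_cases h : ∀ v, v ∈ B
    · exact ⟨B, .exhausted hB h⟩
    · push Not at h
      obtain ⟨u, hu⟩ := h
      obtain ⟨v, hv, hmax⟩ := Finset.exists_max_image Bᶜ (fun w => f (insert w B) - f B)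
        ⟨u, Finset.mem_compl.2 hu⟩
      exact ⟨insert v B, .pick hB (Finset.mem_compl.1 hv) fun w hw =>
        hmax w (Finset.mem_compl.2 hw)⟩

theorem GreedyRun.card_le {k : ℕ} {B : Finset V} (hB : GreedyRun f k B) : B.card ≤ k := by
  induction hB with
  | start => simp
  | pick _ _ _ ih => exact (Finset.card_insert_le _ _).trans (Nat.succ_le_succ ih)
  | exhausted _ _ ih => exact ih.trans (Nat.le_succ _)

theorem le_of_subset_of_le_insert (hmono : ∀ B v, f B ≤ f (insert v B)) {B B' : Finset V}
    (h : B ⊆ B') : f B ≤ f B' := by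
  have key : ∀ T : Finset V, f B ≤ f (B ∪ T) := fun T => by
    induction T using Finset.induction_on with
    | empty => simp
    | insert a T _ ih => rw [Finset.union_insert]; exact ih.trans (hmono _ _)
  simpa [Finset.union_eq_right.2 h] using key B'

/-- For a submodular function, the gain of adding a set is at most its size times a bound on the
marginal gains. -/
theorem sub_le_card_mul_of_submodular
    (hsub : ∀ B B' : Finset V, B ⊆ B' → ∀ v, v ∉ B' →
      f (insert v B') - f B' ≤ f (insert v B) - f B)
    {B : Finset V} {m : ℝ} (hm0 : 0 ≤ m) (hm : ∀ w, w ∉ B → f (insert w B) - f B ≤ m)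
    (T : Finset V) : f (B ∪ T) - f B ≤ T.card * m := by
  induction T using Finset.induction_on with
  | empty => simp
  | insert a T ha ih =>
    rw [Finset.union_insert, Finset.card_insert_of_notMem ha]
    push_cast
    by_cases haB : a ∈ B ∪ T
    · rw [Finset.insert_eq_of_mem haB]
      linarith
    · have h1 := hsub B (B ∪ T) Finset.subset_union_left a haB
      have h2 := hm a fun h => haB (Finset.mem_union_left _ h)
      linarith

/-- Each greedy step closes at least a fraction `1 / K` of the gap to any competitor of size at
most `K`. -/
theorem GreedyRun.sub_le_pow_mul (hmono : ∀ B v, f B ≤ f (insert v B))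
    (hsub : ∀ B B' : Finset V, B ⊆ B' → ∀ v, v ∉ B' →
      f (insert v B') - f B' ≤ f (insert v B) - f B)
    (h0 : ∀ B, 0 ≤ f B) {K : ℕ} (hK : 1 ≤ K) {B' : Finset V} (hB' : B'.card ≤ K) {k : ℕ}
    {B : Finset V} (hB : GreedyRun f k B) : f B' - f B ≤ (1 - 1 / (K : ℝ)) ^ k * f B' := by
  have hK0 : (1 : ℝ) ≤ K := by exact_mod_cast hK
  have hfrac : 0 ≤ 1 - 1 / (K : ℝ) := by
    rw [sub_nonneg, div_le_one (by linarith)]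
    exact hK0
  induction hB with
  | start => simpa using h0 ∅
  | @pick k B v _ _ hmax ih =>
    set m := f (insert v B) - f B with hm
    have hm0 : 0 ≤ m := sub_nonneg.2 (hmono B v)
    have h1 := sub_le_card_mul_of_submodular hsub hm0 hmax B'
    have h2 : f B' ≤ f (B ∪ B') := le_of_subset_of_le_insert hmono Finset.subset_union_right
    have h3 : (B'.card : ℝ) * m ≤ K * m :=
      mul_le_mul_of_nonneg_right (by exact_mod_cast hB') hm0
    have h4 : (f B' - f B) * (1 / K) ≤ m := by
      rw [mul_one_div, div_le_iff₀ (by linarith)]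
      linarith
    have h5 := mul_le_mul_of_nonneg_left ih hfrac
    calc f B' - f (insert v B) = f B' - f B - m := by rw [hm]; ring
      _ ≤ (1 - 1 / (K : ℝ)) * (f B' - f B) := by linarith
      _ ≤ (1 - 1 / (K : ℝ)) ^ (k + 1) * f B' := by rw [pow_succ]; linarith
  | exhausted _ hall _ =>
    have h1 := le_of_subset_of_le_insert hmono (B := B') fun v _ => hall v
    exact (sub_nonpos.2 h1).trans (mul_nonneg (pow_nonneg hfrac _) (h0 B'))

/-- The greedy guarantee for monotone submodular functions. -/
theorem GreedyRun.one_sub_inv_exp_mul_le (hmono : ∀ B v, f B ≤ f (insert v B))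
    (hsub : ∀ B B' : Finset V, B ⊆ B' → ∀ v, v ∉ B' →
      f (insert v B') - f B' ≤ f (insert v B) - f B)
    (h0 : ∀ B, 0 ≤ f B) {K : ℕ} {B B' : Finset V} (hB : GreedyRun f K B)
    (hB' : B'.card ≤ K) : (1 - 1 / Real.exp 1) * f B' ≤ f B := by
  rcases Nat.eq_zero_or_pos K with rfl | hK
  · have e1 : B = ∅ := Finset.card_eq_zero.1 (Nat.le_zero.1 hB.card_le)
    have e2 : B' = ∅ := Finset.card_eq_zero.1 (Nat.le_zero.1 hB')
    subst e1 e2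
    have := mul_nonneg (one_div_nonneg.2 (Real.exp_pos 1).le) (h0 ∅)
    linarith
  · have h1 := hB.sub_le_pow_mul hmono hsub h0 hK hB'
    have h2 : (1 - 1 / (K : ℝ)) ^ K ≤ 1 / Real.exp 1 := by
      rw [one_div (Real.exp 1), ← Real.exp_neg]
      exact Real.one_sub_div_pow_le_exp_neg (by exact_mod_cast hK)
    have h3 := mul_le_mul_of_nonneg_right h2 (h0 B')
    linarith

end Greedy

end

theorem proposition1 {V : Type*} [Fintype V] [DecidableEq V]
    (E : Digraph V) (p : Option V → Option V → Finset (Option V) → unitInterval)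
    (r : V → unitInterval) (ord : AttemptOrder (Option V))
    (hdec : IsDecreasing (tweetGraph E Finset.univ) p)
    (hord : IsOrderIndependent (tweetGraph E Finset.univ) p) (K : ℕ) :
    (∃ B, GreedyRun (expectedRetweets E p r ord) K B) ∧
      ∀ B, GreedyRun (expectedRetweets E p r ord) K B →
        B.card ≤ K ∧
          ∀ B' : Finset V, B'.card ≤ K →
            (1 - 1 / Real.exp 1) * expectedRetweets E p r ord B' ≤
              expectedRetweets E p r ord B :=
  ⟨exists_greedyRun _ K, fun _ hB => ⟨hB.card_le, fun _ hB' =>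
    hB.one_sub_inv_exp_mul_le (expectedRetweets_le_insert hdec hord r ord)
      (fun _ _ hBB _ hv => expectedRetweets_insert_sub_le hdec hord r ord hBB hv)
      (fun _ => Finset.sum_nonneg fun _ _ => mul_nonneg ENNReal.toReal_nonneg (Nat.cast_nonneg _))
      hB'⟩⟩
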